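/- Let $X$ be a real locally convex Hausdorff topological vector space, and let $f$ and $f_k$ ($k\in\mathbb N=\{1,2,\dots\}$) be proper convex lower semicontinuous functions $X\to\mathbb R\cup\{+\infty\}$. Consider the problem $$(\mathrm P_{\mathbb N})\qquad \inf f(x)\ \text{ s.t. } f_k(x)\le 0,\ k\in\mathbb N,$$ its finite subproblems $$(\mathrm P_m)\qquad \inf f(x)\ \text{ s.t. } f_k(x)\le 0,\ k\in\{1,\dots,m\},$$ and the Lagrangian duals (with the rule $0\times(+\infty)=0$) $$(\mathrm D_m)\quad \sup_{\mu\in\mathbb R_+^m}\ \inf_{x\in X}\Big\{f(x)+\sum_{k=1}^m\mu_kf_k(x)\Big\},\qquad (\mathrm D_{\mathbb N})\quad \sup_{\lambda\in\mathbb R_+^{(\mathbb N)}}\ \inf_{x\in X}\Big\{f(x)+\sum_{k\in\mathbb N}\lambda_kf_k(x)\Big\},$$ where $\mathbb R_+^{(\mathbb N)}$ is the set of finitely supported sequences of nonnegative reals. For a proper convex lower semicontinuous function $h$, let $h_\infty$ be its recession function, i.e. the function whose epigraph is the recession cone of the epigraph of $h$, and put $$(\mathrm P)_\infty:=\bigcap_{k\in\mathbb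 N}\{x\in X: (f_k)_\infty(x)\le 0\}\cap\{x\in X: f_\infty(x)\le0\}.$$ Call $h$ weakly inf-locally compact if the sublevel set $\{x\in X: h(x)\le r\}$ is locally compact in the weak topology of $X$ for every $r\in\mathbb R$. Assume that $\inf(\mathrm P_{\mathbb N})\ne+\infty$ and that (g) there exist $N\in\mathbb N$ and $\mu\in\mathbb R_+^N$ such that $f+\sum_{k=1}^N\mu_kf_k$ is weakly inf-locally compact; (e) $(\mathrm P)_\infty$ is a linear subspace of $X$. Then $\inf(\mathrm P_{\mathbb N})$ is a real number, it is attained, and $$\min(\mathrm P_{\mathbb N})=\lim_{m\to\infty}\inf(\mathrm P_m)=\lim_{m\to\infty}\sup(\mathrm D_m)=\sup(\mathrm D_{\mathbb N}).$$ Moreover, the optimal solution set of $(\mathrm P_{\mathbb N})$ is the sum of a weakly compact convex set and a finite-dimensional linear subspace of $X$. -/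

import Mathlib

open Filter Topology Set
open scoped NNReal Pointwise

namespace InfConvex

section Functions

variable {X : Type*} [AddCommGroup X] [Module ℝ X]

/-- The epigraph of `h`, a subset of `X × ℝ`. -/
def epi (h : X → EReal) : Set (X × ℝ) := {p | h p.1 ≤ (p.2 : EReal)}

/-- `h` is proper: its epigraph is nonempty and it never takes the value `-∞`. -/
def Proper (h : X → EReal) : Prop := (epi h).Nonempty ∧ ∀ x, h x ≠ ⊥

/-- The class `Γ(X)` of lower semicontinuous proper convex functions on `X`. -/
structure IsGamma [TopologicalSpace X] (h : X → EReal) : Prop where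
  proper : Proper h
  convex : Convex ℝ (epi h)
  lsc : LowerSemicontinuous h

/-- The recession cone `A_∞` of a convex subset `A` of a real vector space. -/
def recCone {V : Type*} [AddCommGroup V] [Module ℝ V] (A : Set V) : Set V :=
  {d | ∀ a ∈ A, ∀ t : ℝ, 0 ≤ t → a + t • d ∈ A}

/-- The recession function `h_∞` of `h`, the function whose epigraph is `(epi h)_∞`
(see `epi_recFun`). -/
noncomputable def recFun (h : X → EReal) (d : X) : EReal :=
  ⨅ s ∈ {s : ℝ | (d, s) ∈ recCone (epi h)}, (s : EReal)

/-- The defining property of the recession function: `epi h_∞ = (epi h)_∞`. -/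
theorem epi_recFun (h : X → EReal) : epi (recFun h) = recCone (epi h) := by
  ext ⟨d, s⟩
  constructor
  · rintro hs ⟨x, r⟩ hx t ht
    have key : ∀ s' : ℝ, s < s' → h (x + t • d) ≤ ((r + t * s' : ℝ) : EReal) := by
      intro s' hss
      have hlt : recFun h d < (s' : EReal) :=
        lt_of_le_of_lt hs (EReal.coe_lt_coe_iff.2 hss)
      obtain ⟨s₀, h1⟩ := iInf_lt_iff.1 hlt
      obtain ⟨h2, h3⟩ := iInf_lt_iff.1 h1
      have h4 : h (x + t • d) ≤ ((r + t * s₀ : ℝ) : EReal) := h2 (x, r) hx t ht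
      refine h4.trans (EReal.coe_le_coe_iff.2 ?_)
      have := mul_le_mul_of_nonneg_left (EReal.coe_lt_coe_iff.1 h3).le ht
      linarith
    change h (x + t • d) ≤ ((r + t * s : ℝ) : EReal)
    have hlim : Tendsto (fun s' : ℝ => ((r + t * s' : ℝ) : EReal)) (𝓝[>] s)
        (𝓝 ((r + t * s : ℝ) : EReal)) := by
      have hc : Continuous fun s' : ℝ => ((r + t * s' : ℝ) : EReal) :=
        continuous_coe_real_ereal.comp (by fun_prop)
      exact hc.continuousWithinAt
    exact ge_of_tendsto hlim (by
      filter_upwards [self_mem_nhdsWithin] with s' hs'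
      exact key s' hs')
  · intro hs
    exact iInf₂_le (f := fun (s : ℝ) (_ : s ∈ {s : ℝ | (d, s) ∈ recCone (epi h)}) => (s : EReal)) s hs

end Functions

section WeakTopology

variable {X : Type*} [AddCommGroup X] [Module ℝ X] [TopologicalSpace X]

/-- `A` is locally compact for the topology induced by the weak topology of `X`. -/
def WeaklyLocallyCompact (A : Set X) : Prop := LocallyCompactSpace (toWeakSpace ℝ X '' A)

/-- `A` is compact for the weak topology of `X`. -/
def WeaklyCompact (A : Set X) : Prop := IsCompact (toWeakSpace ℝ X '' A)

/-- `h` is weakly inf-locally compact: every sublevel set `[h ≤ r]`, `r ∈ ℝ`, is weakly locally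
compact. -/
def WeaklyInfLocallyCompact (h : X → EReal) : Prop :=
  ∀ r : ℝ, WeaklyLocallyCompact {x | h x ≤ (r : EReal)}

end WeakTopology

section Program

variable {X T : Type*}

/-- The feasible set `{x | F t x ≤ 0 for all t ∈ S}` for the constraints with index in `S`. -/
def feasible (F : T → X → EReal) (S : Set T) : Set X := {x | ∀ t ∈ S, F t x ≤ 0}

/-- The optimal value of: minimize `f x` subject to `F t x ≤ 0` for all `t ∈ S`. -/
noncomputable def infP (f : X → EReal) (F : T → X → EReal) (S : Set T) : EReal :=
  ⨅ x ∈ feasible F S, f x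

/-- The optimal solution set of: minimize `f x` subject to `F t x ≤ 0` for all `t ∈ S`. -/
def sol (f : X → EReal) (F : T → X → EReal) (S : Set T) : Set X :=
  {x ∈ feasible F S | f x = infP f F S}

/-- `f + ∑_{t ∈ H} μ_t f_t` for a finite index set `H` and `μ ∈ ℝ₊^H`. In `EReal` one has
`0 * ⊤ = 0`. -/
noncomputable def lagrangian (f : X → EReal) (F : T → X → EReal) (H : Finset T) (μ : H → ℝ≥0)
    (x : X) : EReal :=
  f x + ∑ t : H, ((μ t : ℝ) : EReal) * F t x

/-- The value of the Lagrangian dual with finitely many constraints, indexed by `H`. -/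
noncomputable def supDFin (f : X → EReal) (F : T → X → EReal) (H : Finset T) : EReal :=
  ⨆ μ : H → ℝ≥0, ⨅ x : X, lagrangian f F H μ x

/-- The value of the Lagrangian-Haar dual, with multipliers the finitely supported nonnegative
families `l ∈ ℝ₊^(T)`. -/
noncomputable def supD (f : X → EReal) (F : T → X → EReal) : EReal :=
  ⨆ l : T →₀ ℝ≥0, ⨅ x : X, f x + ∑ t ∈ l.support, ((l t : ℝ) : EReal) * F t x

/-- The recession cone of the program: `⋂_t [(f_t)_∞ ≤ 0] ∩ [f_∞ ≤ 0]`. -/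
def recConeP [AddCommGroup X] [Module ℝ X] (f : X → EReal) (F : T → X → EReal) : Set X :=
  (⋂ t, {x | recFun (F t) x ≤ 0}) ∩ {x | recFun f x ≤ 0}

end Program

end InfConvex

/-!
Give `X` its weak topology, in which the functions of `Γ(X)` are still lower semicontinuous by
Mazur's theorem, and view the objective and the constraints as one convex system. Its functions are
invariant under translation by the recession space `L`, which is finite-dimensional because it
embeds in a locally compact sublevel set of the given Lagrangian. So everything takes place on a
closed complement `Y` of `L`, where the system has no recession direction. A closed locally
compact convex set without recession directions is compact, and compactness of a sphere shows that
already finitely many functions of the system have compact joint sublevel sets in `Y`.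

Minimizers exist by compactness. If `α` is less than the optimal value, finitely many functions of
the system exclude the objective level `α`. The attainable levels of this finite system form a
closed convex upper set of `ℝⁿ` with bounded lower sections, so the levels `(α, 0, …, 0)` are
separated from it by weights which are all positive. After division by the weight of the objective
they are Lagrange multipliers with dual value at least `α`; positivity avoids the products `0 * ⊤`.
-/

namespace InfConvex

section RecessionCone

variable {E : Type*} [AddCommGroup E] [Module ℝ E] [TopologicalSpace E] {C : Set E}

theorem mem_recCone_of_ray [ContinuousAdd E] [ContinuousSMul ℝ E] (hC : IsClosed C)
    (hconv : Convex ℝ C) {a d : E} (hray : ∀ t : ℝ, 0 ≤ t → a + t • d ∈ C) : d ∈ recCone C := by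
  intro b hb t ht
  have hlim : Tendsto (fun s : ℝ => (1 - s) • b + s • a + t • d) (𝓝[>] 0) (𝓝 (b + t • d)) := by
    have : Continuous fun s : ℝ => (1 - s) • b + s • a + t • d := by fun_prop
    simpa using (this.tendsto 0).mono_left nhdsWithin_le_nhds
  refine hC.mem_of_tendsto hlim ?_
  filter_upwards [Ioo_mem_nhdsGT (zero_lt_one' ℝ)] with s ⟨hs, hs'⟩
  have hmem : (1 - s) • b + s • (a + (t / s) • d) ∈ C :=
    hconv hb (hray _ (div_nonneg ht hs.le)) (sub_nonneg.2 hs'.le) hs.le (sub_add_cancel 1 s)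
  rwa [smul_add, smul_smul, mul_div_cancel₀ _ hs.ne', ← add_assoc] at hmem

theorem recCone_subset_of_isCompact [IsTopologicalAddGroup E] [ContinuousSMul ℝ E] [T2Space E]
    (hC : IsCompact C) (hne : C.Nonempty) : recCone C ⊆ {0} := by
  obtain ⟨a, ha⟩ := hne
  intro d hd
  have hmem (n : ℕ) : a + (n + 1 : ℝ) • d ∈ C := hd a ha _ (by positivity)
  have hlim : Tendsto (fun n : ℕ => (1 / (n + 1) : ℝ) • (a + (n + 1 : ℝ) • d)) atTop (𝓝 0) :=
    (hC.isVonNBounded ℝ).smul_tendsto_zero (.of_forall hmem) tendsto_one_div_add_atTop_nhds_zero_nat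
  have hlim' : Tendsto (fun n : ℕ => (1 / (n + 1) : ℝ) • (a + (n + 1 : ℝ) • d)) atTop (𝓝 d) := by
    have : Tendsto (fun n : ℕ => (1 / (n + 1) : ℝ) • a + d) atTop (𝓝 ((0 : ℝ) • a + d)) :=
      (tendsto_one_div_add_atTop_nhds_zero_nat.smul_const a).add_const d
    simp only [zero_smul, zero_add] at this
    refine this.congr fun n => ?_
    rw [smul_add, smul_smul, one_div_mul_cancel (by positivity), one_smul]
  exact tendsto_nhds_unique hlim' hlim

end RecessionCone

section RecessionFunction

theorem isClosed_epi {E : Type*} [TopologicalSpace E] {h : E → EReal}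
    (hh : LowerSemicontinuous h) : IsClosed (epi h) :=
  hh.isClosed_epigraph.preimage (continuous_id.prodMap continuous_coe_real_ereal)

variable {E : Type*} [AddCommGroup E] [Module ℝ E] {h : E → EReal} {d : E}

theorem recFun_le_zero_iff_mem_recCone : recFun h d ≤ 0 ↔ (d, (0 : ℝ)) ∈ recCone (epi h) := by
  rw [← epi_recFun]
  simp [epi]

theorem recFun_le_zero_iff :
    recFun h d ≤ 0 ↔
      ∀ x (r : ℝ), h x ≤ (r : EReal) → ∀ t : ℝ, 0 ≤ t → h (x + t • d) ≤ (r : EReal) := by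
  simp [recFun_le_zero_iff_mem_recCone, recCone, epi]

theorem apply_add_le_of_recFun_le_zero (hbot : ∀ x, h x ≠ ⊥) (hd : recFun h d ≤ 0) (x : E) :
    h (x + d) ≤ h x := by
  rcases eq_or_ne (h x) ⊤ with hx | hx
  · simp [hx]
  · lift h x to ℝ using ⟨hx, hbot x⟩ with r hr
    simpa using recFun_le_zero_iff.1 hd x r hr.ge 1 zero_le_one

theorem apply_add_eq_of_recFun_le_zero (hbot : ∀ x, h x ≠ ⊥) (hd : recFun h d ≤ 0)
    (hd' : recFun h (-d) ≤ 0) (x : E) : h (x + d) = h x :=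
  (apply_add_le_of_recFun_le_zero hbot hd x).antisymm <| by
    simpa using apply_add_le_of_recFun_le_zero hbot hd' (x + d)

theorem convex_sublevel_of_convex_epi (hc : Convex ℝ (epi h)) (r : ℝ) :
    Convex ℝ {x | h x ≤ (r : EReal)} := by
  intro x hx y hy a b ha hb hab
  have := @hc (x, r) hx (y, r) hy a b ha hb hab
  have hr : a * r + b * r = r := by rw [← add_mul, hab, one_mul]
  simpa [epi, ← EReal.coe_mul, ← EReal.coe_add, hr] using this

theorem convex_preimage_Iic_of_convex_epi (hc : Convex ℝ (epi h)) (y : EReal) :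
    Convex ℝ (h ⁻¹' Iic y) := by
  have : h ⁻¹' Iic y = ⋂ (r : ℝ) (_ : y < r), {x | h x ≤ (r : EReal)} := by
    ext x
    simp only [mem_preimage, mem_Iic, mem_iInter, mem_ofPred_eq, EReal.le_of_forall_lt_iff_le]
  rw [this]
  exact convex_iInter₂ fun r _ => convex_sublevel_of_convex_epi hc r

variable [TopologicalSpace E] [ContinuousAdd E] [ContinuousSMul ℝ E]

theorem IsGamma.recFun_le_zero_of_ray (hh : IsGamma h) {a : E} {r : ℝ}
    (hray : ∀ t : ℝ, 0 ≤ t → h (a + t • d) ≤ (r : EReal)) : recFun h d ≤ 0 :=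
  recFun_le_zero_iff_mem_recCone.2 <|
    mem_recCone_of_ray (isClosed_epi hh.lsc) hh.convex (a := (a, r)) fun t ht => by
      simpa [epi] using hray t ht

theorem IsGamma.isClosed_recFun_le_zero (hh : IsGamma h) : IsClosed {d | recFun h d ≤ 0} := by
  obtain ⟨⟨a, r⟩, ha⟩ := hh.proper.1
  have : {d | recFun h d ≤ 0} =
      ⋂ (t : ℝ) (_ : 0 ≤ t), (fun d => a + t • d) ⁻¹' {x | h x ≤ (r : EReal)} := by
    ext d
    simp only [mem_iInter, mem_preimage, mem_ofPred_eq]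
    exact ⟨fun hd => recFun_le_zero_iff.1 hd a r ha, hh.recFun_le_zero_of_ray⟩
  rw [this]
  exact isClosed_biInter fun t _ => (hh.lsc.isClosed_preimage r).preimage (by fun_prop)

end RecessionFunction

section JointSublevel

variable {ι E : Type*}

/-- The set of points at which every member of the family `g` is bounded by its level: the
sublevel set of a convex system `g i x ≤ y i`, `i ∈ ι`. -/
def jointSublevel (g : ι → E → EReal) (y : ι → ℝ) : Set E := {x | ∀ i, g i x ≤ (y i : EReal)}

variable {g : ι → E → EReal}

theorem jointSublevel_eq_iInter (y : ι → ℝ) :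
    jointSublevel g y = ⋂ i, {x | g i x ≤ (y i : EReal)} :=
  ofPred_forall _

theorem isClosed_jointSublevel [TopologicalSpace E] (hg : ∀ i, LowerSemicontinuous (g i))
    (y : ι → ℝ) : IsClosed (jointSublevel g y) := by
  rw [jointSublevel_eq_iInter]
  exact isClosed_iInter fun i => (hg i).isClosed_preimage _

variable [AddCommGroup E] [Module ℝ E]

theorem convex_jointSublevel (hg : ∀ i, Convex ℝ (epi (g i))) (y : ι → ℝ) :
    Convex ℝ (jointSublevel g y) := by
  rw [jointSublevel_eq_iInter]
  exact convex_iInter fun i => convex_sublevel_of_convex_epi (hg i) _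

theorem mem_recCone_inter_jointSublevel [TopologicalSpace E] [ContinuousAdd E] [ContinuousSMul ℝ E]
    (hg : ∀ i, IsGamma (g i)) (Y : Submodule ℝ E) {y : ι → ℝ}
    (hne : (Y ∩ jointSublevel g y : Set E).Nonempty) {d : E} :
    d ∈ recCone (Y ∩ jointSublevel g y) ↔ d ∈ Y ∧ ∀ i, recFun (g i) d ≤ 0 := by
  obtain ⟨a, haY, ha⟩ := hne
  constructor
  · intro hd
    refine ⟨(Y.add_mem_iff_right haY).1 ?_, fun i => (hg i).recFun_le_zero_of_ray fun t ht =>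
      (hd a ⟨haY, ha⟩ t ht).2 i⟩
    simpa using (hd a ⟨haY, ha⟩ 1 zero_le_one).1
  · rintro ⟨hdY, hd⟩ x ⟨hxY, hx⟩ t ht
    exact ⟨Y.add_mem hxY (Y.smul_mem t hdY), fun i =>
      recFun_le_zero_iff.1 (hd i) x (y i) (hx i) t ht⟩

end JointSublevel

section LocallyCompact

theorem locallyCompactSpace_of_isClosed_subset {E : Type*} [TopologicalSpace E] {A B : Set E}
    (_ : LocallyCompactSpace B) (hA : IsClosed A) (hAB : A ⊆ B) : LocallyCompactSpace A :=
  (Topology.IsClosedEmbedding.inclusion hAB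
    (hA.preimage continuous_subtype_val)).locallyCompactSpace

theorem finiteDimensional_of_add_mem {E : Type*} [AddCommGroup E] [Module ℝ E] [TopologicalSpace E]
    [IsTopologicalAddGroup E] [ContinuousSMul ℝ E] [T2Space E] {L : Submodule ℝ E}
    (hL : IsClosed (L : Set E)) {B : Set E} (hB : LocallyCompactSpace B) {a : E}
    (ha : ∀ d ∈ L, a + d ∈ B) : FiniteDimensional ℝ L := by
  have hemb : Topology.IsClosedEmbedding (fun d : L => a + (d : E)) :=
    (Homeomorph.addLeft a).isClosedEmbedding.comp hL.isClosedEmbedding_subtypeVal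
  have : LocallyCompactSpace (range fun d : L => a + (d : E)) :=
    locallyCompactSpace_of_isClosed_subset hB hemb.isClosed_range
      (range_subset_iff.2 fun d => ha d d.2)
  have : LocallyCompactSpace L :=
    hemb.isEmbedding.toHomeomorph.isClosedEmbedding.locallyCompactSpace
  exact FiniteDimensional.of_locallyCompactSpace ℝ

end LocallyCompact

section Compactness

theorem add_smul_mem_of_le {E : Type*} [AddCommGroup E] [Module ℝ E] {C : Set E}
    (hC : Convex ℝ C) {a z : E} (ha : a ∈ C) {s t : ℝ} (hz : a + t • z ∈ C) (hs : 0 ≤ s)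
    (hst : s ≤ t) : a + s • z ∈ C := by
  rcases hs.eq_or_lt with rfl | hs
  · simpa using ha
  · have ht : 0 < t := hs.trans_le hst
    have := hC.add_smul_mem ha hz ⟨(div_pos hs ht).le, (div_le_one ht).2 hst⟩
    rwa [smul_smul, div_mul_cancel₀ _ ht.ne'] at this

variable {E : Type*} [AddCommGroup E] [Module ℝ E] [TopologicalSpace E]
  [IsTopologicalAddGroup E] [ContinuousSMul ℝ E] {C : Set E} {a : E}

theorem exists_continuous_seminorm_closedUnitBall_subset [LocallyConvexSpace ℝ E] {V : Set E}
    (hV : V ∈ 𝓝 (0 : E)) :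
    ∃ p : Seminorm ℝ E, Continuous p ∧ {x | p x ≤ 1} ⊆ V := by
  obtain ⟨U, ⟨hU0, hUo, hUb, hUc⟩, hUV⟩ := (nhds_hasBasis_absConvex_open ℝ E).mem_iff.1 hV
  let q : Seminorm ℝ E := gaugeSeminorm hUb hUc (absorbent_nhds_zero (hUo.mem_nhds hU0))
  have hq : Continuous q := continuous_gauge hUc (hUo.mem_nhds hU0)
  refine ⟨(2 : ℝ≥0) • q, hq.const_smul (2 : ℝ≥0), fun x hx => hUV ?_⟩
  have hx : 2 * q x ≤ 1 := hx
  have : x ∈ q.ball 0 1 := q.mem_ball_zero.2 (by linarith)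
  rwa [gaugeSeminorm_ball_one hUo] at this

theorem exists_seminorm_isCompact_of_locallyCompact [LocallyConvexSpace ℝ E] (hC : IsClosed C)
    (hlc : LocallyCompactSpace C) (ha : a ∈ C) :
    ∃ p : Seminorm ℝ E, Continuous p ∧ IsCompact {z | a + z ∈ C ∧ p z ≤ 1} := by
  obtain ⟨K, hK, hKn⟩ := exists_compact_mem_nhds (⟨a, ha⟩ : C)
  obtain ⟨V, hV, hVK⟩ := mem_nhds_subtype C ⟨a, ha⟩ K |>.1 hKn
  have hV0 : (a + ·) ⁻¹' V ∈ 𝓝 (0 : E) :=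
    (continuous_const_add a).continuousAt.preimage_mem_nhds (by simpa using hV)
  obtain ⟨p, hp, hpV⟩ := exists_continuous_seminorm_closedUnitBall_subset hV0
  refine ⟨p, hp, ?_⟩
  have hK' : IsCompact ((· - a) '' (Subtype.val '' K)) :=
    (hK.image continuous_subtype_val).image (by fun_prop)
  refine hK'.of_isClosed_subset
    ((hC.preimage (continuous_const_add a)).inter (isClosed_le hp continuous_const)) ?_
  rintro z ⟨hz, hpz⟩
  exact ⟨a + z, ⟨⟨a + z, hz⟩, hVK (hpV hpz), rfl⟩, add_sub_cancel_left a z⟩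

theorem isCompact_of_seminorm_sub_le (hC : IsClosed C) (hconv : Convex ℝ C) (ha : a ∈ C)
    {p : Seminorm ℝ E} (hcomp : IsCompact {z | a + z ∈ C ∧ p z ≤ 1}) {R : ℝ}
    (hR : ∀ x ∈ C, p (x - a) ≤ R) : IsCompact C := by
  have hR' : 0 < max R 1 := lt_max_of_lt_right one_pos
  refine (hcomp.image (f := fun z => a + max R 1 • z) (by fun_prop)).of_isClosed_subset hC ?_
  intro x hx
  refine ⟨(max R 1)⁻¹ • (x - a), ⟨?_, ?_⟩, by simp [smul_smul, hR'.ne']⟩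
  · exact add_smul_mem_of_le hconv ha (t := 1) (by simpa using hx) (inv_nonneg.2 hR'.le)
      (inv_le_one_of_one_le₀ (le_max_right R 1))
  · rw [map_smul_eq_mul, Real.norm_of_nonneg (inv_nonneg.2 hR'.le), inv_mul_le_one₀ hR']
    exact (hR x hx).trans (le_max_left R 1)

variable {κ : Type*} [Preorder κ] [IsDirectedOrder κ] [Nonempty κ] {D : κ → Set E}

theorem exists_disjoint_sphere_of_recCone_iInter_subset (hanti : Antitone D)
    (hclosed : ∀ i, IsClosed (D i)) (hconv : ∀ i, Convex ℝ (D i)) (ha : ∀ i, a ∈ D i)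
    (hrec : recCone (⋂ i, D i) ⊆ {0}) {p : Seminorm ℝ E} (hp : Continuous p) {K : Set E}
    (hK : IsCompact K) :
    ∃ (i : κ) (s : ℝ≥0), ∀ z ∈ K, 1 ≤ p z → a + (s : ℝ) • z ∉ D i := by
  let S : κ × ℝ≥0 → Set E := fun j => {z | 1 ≤ p z ∧ a + (j.2 : ℝ) • z ∈ D j.1}
  have hS_closed (j : κ × ℝ≥0) : IsClosed (S j) :=
    (isClosed_le continuous_const hp).inter ((hclosed j.1).preimage (by fun_prop))
  have hS_anti : Antitone S := fun j j' hj z hz =>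
    ⟨hz.1, add_smul_mem_of_le (hconv j.1) (ha j.1) (hanti hj.1 hz.2) j.2.2 hj.2⟩
  have hS_empty : K ∩ ⋂ j, S j = ∅ := by
    refine eq_empty_of_forall_notMem fun z ⟨_, hz⟩ => ?_
    rw [mem_iInter] at hz
    have hray (t : ℝ) (ht : 0 ≤ t) : a + t • z ∈ ⋂ i, D i :=
      mem_iInter.2 fun i => (hz (i, ⟨t, ht⟩)).2
    have hz0 : z = 0 :=
      hrec (mem_recCone_of_ray (isClosed_iInter hclosed) (convex_iInter hconv) hray)
    have hpz : 1 ≤ p z := (hz (Classical.arbitrary κ, 0)).1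
    exact absurd hpz (by simp [hz0])
  have hS_directed : Directed (· ⊇ ·) S := fun j j' =>
    have ⟨i, hi, hi'⟩ := exists_ge_ge j.1 j'.1
    ⟨(i, max j.2 j'.2), hS_anti ⟨hi, le_max_left _ _⟩, hS_anti ⟨hi', le_max_right _ _⟩⟩
  obtain ⟨⟨i, s⟩, his⟩ := hK.elim_directed_family_closed S hS_closed hS_empty hS_directed
  exact ⟨i, s, fun z hzK hpz hz => notMem_empty z (his ▸ ⟨hzK, hpz, hz⟩)⟩

variable [LocallyConvexSpace ℝ E]

theorem exists_isCompact_of_recCone_iInter_subset (hanti : Antitone D)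
    (hclosed : ∀ i, IsClosed (D i)) (hconv : ∀ i, Convex ℝ (D i)) {i₀ : κ}
    (hlc : LocallyCompactSpace (D i₀)) (hne : (⋂ i, D i).Nonempty)
    (hrec : recCone (⋂ i, D i) ⊆ {0}) : ∃ i, IsCompact (D i) := by
  obtain ⟨a, ha⟩ := hne
  rw [mem_iInter] at ha
  obtain ⟨p, hp, hK⟩ := exists_seminorm_isCompact_of_locallyCompact (hclosed i₀) hlc (ha i₀)
  obtain ⟨i₁, s, hs⟩ :=
    exists_disjoint_sphere_of_recCone_iInter_subset hanti hclosed hconv ha hrec hp hK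
  obtain ⟨i, hi₀, hi₁⟩ := exists_ge_ge i₀ i₁
  have hcomp : IsCompact {z | a + z ∈ D i ∧ p z ≤ 1} :=
    hK.of_isClosed_subset
      (((hclosed i).preimage (continuous_const_add a)).inter (isClosed_le hp continuous_const))
      fun z hz => ⟨hanti hi₀ hz.1, hz.2⟩
  refine ⟨i, isCompact_of_seminorm_sub_le (hclosed i) (hconv i) (ha i) hcomp
    (R := max s 1) fun x hx => ?_⟩
  by_contra! hlt
  obtain ⟨hsx, h1x⟩ := max_lt_iff.1 hlt
  have hpos : 0 < p (x - a) := one_pos.trans h1x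
  have hscale {t : ℝ} (ht : 0 ≤ t) (ht' : t ≤ 1) : a + t • (x - a) ∈ D i :=
    add_smul_mem_of_le (hconv i) (ha i) (t := 1) (by simpa using hx) ht ht'
  have hp1 : p ((p (x - a))⁻¹ • (x - a)) = 1 := by
    rw [map_smul_eq_mul, Real.norm_of_nonneg (inv_nonneg.2 hpos.le), inv_mul_cancel₀ hpos.ne']
  refine hs ((p (x - a))⁻¹ • (x - a)) ⟨?_, hp1.le⟩ hp1.ge ?_
  · exact hanti hi₀ (hscale (inv_nonneg.2 hpos.le) (inv_le_one_of_one_le₀ h1x.le))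
  · rw [smul_smul, ← div_eq_mul_inv]
    exact hanti hi₁ (hscale (by positivity) ((div_le_one hpos).2 hsx.le))

theorem isCompact_of_recCone_subset (hC : IsClosed C) (hconv : Convex ℝ C)
    (hlc : LocallyCompactSpace C) (hne : C.Nonempty) (hrec : recCone C ⊆ {0}) : IsCompact C := by
  obtain ⟨-, hcomp⟩ := exists_isCompact_of_recCone_iInter_subset (κ := Unit) (D := fun _ => C)
    antitone_const (fun _ => hC) (fun _ => hconv) (i₀ := ()) hlc (by rwa [iInter_const])
    (by rwa [iInter_const])
  exact hcomp

theorem isCompact_inter_jointSublevel [T2Space E] {ι : Type*} {g : ι → E → EReal}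
    (hg : ∀ i, IsGamma (g i)) {Y : Submodule ℝ E} (hY : IsClosed (Y : Set E)) {y y₀ : ι → ℝ}
    (hne : (Y ∩ jointSublevel g y₀ : Set E).Nonempty)
    (hcomp : IsCompact (Y ∩ jointSublevel g y₀ : Set E))
    (hlc : LocallyCompactSpace (Y ∩ jointSublevel g y : Set E)) :
    IsCompact (Y ∩ jointSublevel g y : Set E) := by
  rcases (Y ∩ jointSublevel g y : Set E).eq_empty_or_nonempty with hempty | hne'
  · rw [hempty]
    exact isCompact_empty
  refine isCompact_of_recCone_subset (hY.inter (isClosed_jointSublevel (fun i => (hg i).lsc) y))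
    (Y.convex.inter (convex_jointSublevel (fun i => (hg i).convex) y)) hlc hne' fun d hd => ?_
  refine recCone_subset_of_isCompact hcomp hne ?_
  rwa [mem_recCone_inter_jointSublevel hg Y hne, ← mem_recCone_inter_jointSublevel hg Y hne']

end Compactness

section Separation

variable {ι : Type*} [Fintype ι] {A : Set (ι → ℝ)}

theorem exists_nonneg_dotProduct_separating (hA : Convex ℝ A) (hclosed : IsClosed A)
    (hupper : IsUpperSet A) (hne : A.Nonempty) {K : Set (ι → ℝ)} (hK : Convex ℝ K)
    (hKc : IsCompact K) (hdisj : Disjoint K A) :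
    ∃ (ν : ι → ℝ) (u : ℝ), 0 ≤ ν ∧ (∀ k ∈ K, ν ⬝ᵥ k < u) ∧ ∀ y ∈ A, u ≤ ν ⬝ᵥ y := by
  classical
  obtain ⟨φ, u, v, hφK, huv, hφA⟩ := geometric_hahn_banach_compact_closed hK hKc hA hclosed hdisj
  let ν : ι → ℝ := fun i => φ (Pi.single i 1)
  have hφ (y : ι → ℝ) : φ y = ν ⬝ᵥ y := by
    conv_lhs => rw [pi_eq_sum_univ' y]
    simp [ν, dotProduct, mul_comm]
  simp only [hφ] at hφK hφA
  refine ⟨ν, v, fun i => ?_, fun k hk => (hφK k hk).trans huv, fun y hy => (hφA y hy).le⟩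
  by_contra! hneg
  replace hneg : ν i < 0 := hneg
  obtain ⟨a, ha⟩ := hne
  let t : ℝ := (ν ⬝ᵥ a - v) / -ν i
  have ht : 0 ≤ t := div_nonneg (sub_nonneg.2 (hφA a ha).le) (neg_nonneg.2 hneg.le)
  have hmem : a + Pi.single i t ∈ A :=
    hupper (le_add_of_nonneg_right (Pi.single_nonneg.2 ht)) ha
  have hval : ν ⬝ᵥ (a + Pi.single i t) = v := by
    rw [dotProduct_add, dotProduct_single]
    simp only [t]
    field_simp [hneg.ne]
    ring
  exact (hφA _ hmem).ne' hval

theorem exists_pos_dotProduct_bddBelow (hA : Convex ℝ A) (hclosed : IsClosed A)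
    (hupper : IsUpperSet A) {a : ι → ℝ} (ha : a ∈ A) (hbdd : BddBelow (A ∩ Iic a)) :
    ∃ (w : ι → ℝ) (v : ℝ), (∀ i, 0 < w i) ∧ ∀ y ∈ A, v ≤ w ⬝ᵥ y := by
  classical
  obtain ⟨c, hc⟩ := hbdd
  -- Separate `A` from the simplex `{z ≤ a | ∑ z = ∑ c - 1}`: as `a ∈ A` lies above each of its
  -- vertices `a - T eᵢ` in the direction `eᵢ`, the weights are positive.
  let T : ℝ := ∑ i, (a i - c i) + 1
  have hT : 0 < T :=
    add_pos_of_nonneg_of_pos (Finset.sum_nonneg fun i _ => sub_nonneg.2 (hc ⟨ha, self_mem_Iic⟩ i))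
      one_pos
  have hdisj : Disjoint (a +ᵥ -T • stdSimplex ℝ ι) A := by
    rw [Set.disjoint_left]
    rintro _ ⟨_, ⟨e, he, rfl⟩, rfl⟩ hmem
    replace hmem : a - T • e ∈ A := by simpa [sub_eq_add_neg] using hmem
    have hle : a - T • e ≤ a := sub_le_self a (smul_nonneg hT.le he.1)
    have hsum : ∑ i, c i ≤ ∑ i, (a - T • e) i := Finset.sum_le_sum fun i _ => hc ⟨hmem, hle⟩ i
    simp only [Pi.sub_apply, Pi.smul_apply, smul_eq_mul, Finset.sum_sub_distrib, ← Finset.mul_sum,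
      he.2, T] at hsum
    linarith
  obtain ⟨w, v, -, hwK, hwA⟩ := exists_nonneg_dotProduct_separating hA hclosed hupper ⟨a, ha⟩
    (((convex_stdSimplex ℝ ι).smul (-T)).vadd a) (((isCompact_stdSimplex ℝ ι).smul (-T)).vadd a)
    hdisj
  refine ⟨w, v, fun i => ?_, hwA⟩
  have hlt : w ⬝ᵥ (a + -T • Pi.single i 1) < w ⬝ᵥ a :=
    (hwK _ (vadd_mem_vadd_set (smul_mem_smul_set (single_mem_stdSimplex ℝ i)))).trans_le (hwA a ha)
  rw [dotProduct_add, dotProduct_smul, dotProduct_single, mul_one, add_lt_iff_neg_left,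
    smul_eq_mul, neg_mul, neg_lt_zero] at hlt
  exact pos_of_mul_pos_right hlt hT.le

theorem exists_pos_dotProduct_separating (hA : Convex ℝ A) (hclosed : IsClosed A)
    (hupper : IsUpperSet A) {a : ι → ℝ} (ha : a ∈ A) (hbdd : BddBelow (A ∩ Iic a)) {p : ι → ℝ}
    (hp : p ∉ A) : ∃ w : ι → ℝ, (∀ i, 0 < w i) ∧ ∀ y ∈ A, w ⬝ᵥ p ≤ w ⬝ᵥ y := by
  obtain ⟨ν, u, hν, hνp, hνA⟩ := exists_nonneg_dotProduct_separating hA hclosed hupper ⟨a, ha⟩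
    (convex_singleton p) isCompact_singleton (disjoint_singleton_left.2 hp)
  -- Adding a small multiple of a positive functional bounded below on `A` keeps the separation.
  obtain ⟨w, v, hw, hwA⟩ := exists_pos_dotProduct_bddBelow hA hclosed hupper ha hbdd
  obtain ⟨ε, hε, hεp⟩ : ∃ ε > 0, ν ⬝ᵥ p + ε * (w ⬝ᵥ p - v) < u := by
    have hlim : Tendsto (fun ε : ℝ => ν ⬝ᵥ p + ε * (w ⬝ᵥ p - v)) (𝓝[>] 0) (𝓝 (ν ⬝ᵥ p)) := by
      have : Continuous fun ε : ℝ => ν ⬝ᵥ p + ε * (w ⬝ᵥ p - v) := by fun_prop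
      simpa using (this.tendsto 0).mono_left nhdsWithin_le_nhds
    exact ((eventually_mem_nhdsWithin (s := Ioi (0 : ℝ))).and
      (hlim.eventually (gt_mem_nhds (hνp p rfl)))).exists
  refine ⟨ν + ε • w, fun i => add_pos_of_nonneg_of_pos (hν i) (mul_pos hε (hw i)), fun y hy => ?_⟩
  have hmul : ε * v ≤ ε * w ⬝ᵥ y := mul_le_mul_of_nonneg_left (hwA y hy) (le_of_lt hε)
  simp only [add_dotProduct, smul_dotProduct, smul_eq_mul]
  linarith [hνA y hy]

end Separation

section AttainableLevels

variable {ι E : Type*} {g : ι → E → EReal} {K : Set E}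

/-- The vectors of levels of `g` attainable on `K`: the projection to `ℝ^ι` of the joint
epigraph. It is the set of right-hand sides `y` for which the system `g i x ≤ y i` has a solution
in `K`. -/
def attainableLevels (g : ι → E → EReal) (K : Set E) : Set (ι → ℝ) :=
  {y | (K ∩ jointSublevel g y).Nonempty}

theorem jointSublevel_mono : Monotone (jointSublevel g) :=
  fun _ _ h _ hx i => (hx i).trans (EReal.coe_le_coe_iff.2 (h i))

theorem isUpperSet_attainableLevels : IsUpperSet (attainableLevels g K) :=
  fun _ _ h hy => hy.mono (inter_subset_inter_right K (jointSublevel_mono h))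

theorem convex_attainableLevels [AddCommGroup E] [Module ℝ E] (hg : ∀ i, Convex ℝ (epi (g i)))
    (hK : Convex ℝ K) : Convex ℝ (attainableLevels g K) := by
  rintro y ⟨x, hx, hxy⟩ z ⟨x', hx', hxz⟩ s t hs ht hst
  exact ⟨s • x + t • x', hK hx hx' hs ht hst, fun i =>
    @hg i (x, y i) (hxy i) (x', z i) (hxz i) s t hs ht hst⟩

variable [TopologicalSpace E]

theorem exists_coe_le_of_isCompact {h : E → EReal} (hlsc : LowerSemicontinuous h)
    (hbot : ∀ x, h x ≠ ⊥) (hK : IsCompact K) : ∃ c : ℝ, ∀ x ∈ K, (c : EReal) ≤ h x := by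
  rcases K.eq_empty_or_nonempty with rfl | hne
  · exact ⟨0, by simp⟩
  obtain ⟨a, -, ha⟩ := (hlsc.lowerSemicontinuousOn K).exists_isMinOn hne hK
  obtain ⟨c, -, hc⟩ := EReal.lt_iff_exists_real_btwn.1 (bot_lt_iff_ne_bot.2 (hbot a))
  exact ⟨c, fun x hx => hc.le.trans (ha hx)⟩

theorem bddBelow_attainableLevels_inter_Iic (hg : ∀ i, LowerSemicontinuous (g i))
    (hbot : ∀ i x, g i x ≠ ⊥) {a : ι → ℝ} (hcomp : IsCompact (K ∩ jointSublevel g a)) :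
    BddBelow (attainableLevels g K ∩ Iic a) := by
  choose c hc using fun i => exists_coe_le_of_isCompact (hg i) (hbot i) hcomp
  refine ⟨c, fun y ⟨⟨x, hxK, hx⟩, hya⟩ i => ?_⟩
  exact EReal.coe_le_coe_iff.1 ((hc i x ⟨hxK, jointSublevel_mono hya hx⟩).trans (hx i))

theorem isClosed_attainableLevels [Finite ι] (hg : ∀ i, LowerSemicontinuous (g i))
    (hcomp : ∀ y, IsCompact (K ∩ jointSublevel g y)) : IsClosed (attainableLevels g K) := by
  refine isClosed_of_closure_subset fun y hy => ?_
  let Q : Set E := K ∩ jointSublevel g (y + 1)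
  have : CompactSpace Q := isCompact_iff_compactSpace.1 (hcomp (y + 1))
  let S : Set (Q × (ι → ℝ)) := {p | ∀ i, g i p.1 ≤ (p.2 i : EReal)}
  have hS : IsClosed S := by
    simp only [S, ofPred_forall]
    exact isClosed_iInter fun i => (isClosed_epi (hg i)).preimage
      (f := fun p : Q × (ι → ℝ) => ((p.1 : E), p.2 i)) (by fun_prop)
  have hnear : ∀ᶠ y' in 𝓝 y, y' ≤ y + 1 := pi_Iic_mem_nhds fun i => lt_add_one (y i)
  have hfreq : ∃ᶠ y' in 𝓝 y, y' ∈ Prod.snd '' S :=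
    ((mem_closure_iff_frequently.1 hy).and_eventually hnear).mono
      fun y' ⟨⟨x, hxK, hx⟩, hle⟩ => ⟨(⟨x, hxK, jointSublevel_mono hle hx⟩, y'), hx, rfl⟩
  obtain ⟨⟨x, y'⟩, hx, hy' : y' = y⟩ :=
    (isClosedMap_snd_of_compactSpace S hS).mem_of_frequently_of_tendsto hfreq tendsto_id
  exact ⟨x, x.2.1, hy' ▸ hx⟩

theorem exists_pos_weights [Fintype ι] [AddCommGroup E] [Module ℝ E] (hg : ∀ i, IsGamma (g i))
    (hK : Convex ℝ K) (hcomp : ∀ y, IsCompact (K ∩ jointSublevel g y))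
    (hne : (attainableLevels g K).Nonempty) {y : ι → ℝ} (hy : y ∉ attainableLevels g K) (i₀ : ι) :
    ∃ w : ι → ℝ, (∀ i, 0 < w i) ∧ w i₀ = 1 ∧ ∀ z ∈ attainableLevels g K, w ⬝ᵥ y ≤ w ⬝ᵥ z := by
  obtain ⟨a, ha⟩ := hne
  obtain ⟨w, hw, hwA⟩ := exists_pos_dotProduct_separating
    (convex_attainableLevels (fun i => (hg i).convex) hK)
    (isClosed_attainableLevels (fun i => (hg i).lsc) hcomp) isUpperSet_attainableLevels ha
    (bddBelow_attainableLevels_inter_Iic (fun i => (hg i).lsc) (fun i => (hg i).proper.2)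
      (hcomp a)) hy
  have hinv : 0 < (w i₀)⁻¹ := inv_pos.2 (hw i₀)
  refine ⟨(w i₀)⁻¹ • w, fun i => mul_pos hinv (hw i), inv_mul_cancel₀ (hw i₀).ne', fun z hz => ?_⟩
  simp only [smul_dotProduct]
  exact smul_le_smul_of_nonneg_left (hwA z hz) hinv.le

end AttainableLevels

section EReal

variable {ι : Type*}

theorem ereal_coe_sum (s : Finset ι) (u : ι → ℝ) :
    ((∑ i ∈ s, u i : ℝ) : EReal) = ∑ i ∈ s, (u i : EReal) :=
  map_sum (⟨⟨Real.toEReal, EReal.coe_zero⟩, EReal.coe_add⟩ : ℝ →+ EReal) u s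

theorem ereal_sum_ne_bot {s : Finset ι} {u : ι → EReal} (hu : ∀ i ∈ s, u i ≠ ⊥) :
    ∑ i ∈ s, u i ≠ ⊥ :=
  Finset.sum_induction u (· ≠ ⊥) (fun _ _ ha hb => EReal.add_ne_bot_iff.2 ⟨ha, hb⟩) (by simp) hu

theorem ereal_sum_eq_top {s : Finset ι} {u : ι → EReal} (hu : ∀ i ∈ s, u i ≠ ⊥) {j : ι}
    (hj : j ∈ s) (huj : u j = ⊤) : ∑ i ∈ s, u i = ⊤ := by
  classical
  rw [← Finset.add_sum_erase s u hj, huj]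
  exact EReal.top_add_of_ne_bot (ereal_sum_ne_bot fun i hi => hu i (Finset.mem_of_mem_erase hi))

theorem coe_le_sum_coe_mul [Fintype ι] {w : ι → ℝ} (hw : ∀ i, 0 < w i) {u : ι → EReal}
    (hu : ∀ i, u i ≠ ⊥) {α : ℝ} (h : ∀ z : ι → ℝ, (∀ i, u i ≤ (z i : EReal)) → α ≤ w ⬝ᵥ z) :
    (α : EReal) ≤ ∑ i, (w i : EReal) * u i := by
  by_cases htop : ∃ j, u j = ⊤
  · obtain ⟨j, hj⟩ := htop
    have hterm (i : ι) : (w i : EReal) * u i ≠ ⊥ := by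
      induction hi : u i with
      | bot => exact absurd hi (hu i)
      | coe r => exact EReal.coe_ne_bot (w i * r)
      | top => simp [EReal.coe_mul_top_of_pos (hw i)]
    rw [ereal_sum_eq_top (fun i _ => hterm i) (Finset.mem_univ j)
      (by rw [hj, EReal.coe_mul_top_of_pos (hw j)])]
    exact le_top
  · push Not at htop
    lift u to ι → ℝ using fun i => ⟨htop i, hu i⟩
    simp only [← EReal.coe_mul, ← ereal_coe_sum]
    exact EReal.coe_le_coe_iff.2 (h u fun _ => le_rfl)

end EReal

section Multipliers

theorem exists_finset_restrict_notMem_attainableLevels {ι E : Type*} [TopologicalSpace E]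
    {g : ι → E → EReal} {K : Set E} (hg : ∀ i, LowerSemicontinuous (g i)) {S : Finset ι}
    {y : ι → ℝ} (hcomp : IsCompact (K ∩ jointSublevel (S.restrict g) (S.restrict y)))
    (hy : y ∉ attainableLevels g K) (i₀ : ι) :
    ∃ S' : Finset ι, S ⊆ S' ∧ i₀ ∈ S' ∧ S'.restrict y ∉ attainableLevels (S'.restrict g) K := by
  classical
  obtain ⟨u, hu⟩ := hcomp.elim_finite_subfamily_closed (fun i => {x | g i x ≤ (y i : EReal)})
    (fun i => (hg i).isClosed_preimage _) <| by
      rw [← jointSublevel_eq_iInter]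
      exact eq_empty_of_forall_notMem fun x ⟨⟨hxK, _⟩, hx⟩ => hy ⟨x, hxK, hx⟩
  refine ⟨insert i₀ (S ∪ u), ?_, Finset.mem_insert_self _ _, fun ⟨x, hxK, hx⟩ => ?_⟩
  · exact Finset.subset_union_left.trans (Finset.subset_insert _ _)
  · replace hx (i) (hi : i ∈ insert i₀ (S ∪ u)) : g i x ≤ (y i : EReal) := hx ⟨i, hi⟩
    refine notMem_empty x (hu ▸ ⟨⟨hxK, fun i => hx i (by simp)⟩, mem_iInter₂.2 fun i hi => hx i ?_⟩)
    simp [hi]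

variable {ι E : Type*} [TopologicalSpace E] {g : ι → E → EReal} {K : Set E}

theorem isCompact_inter_jointSublevel_of_subset (hg : ∀ i, LowerSemicontinuous (g i))
    {S S' : Finset ι} (hSS' : S ⊆ S')
    (hcomp : ∀ y, IsCompact (K ∩ jointSublevel (S.restrict g) y)) (y : S' → ℝ) :
    IsCompact (K ∩ jointSublevel (S'.restrict g) y) := by
  have hsub : jointSublevel (S'.restrict g) y ⊆
      jointSublevel (S.restrict g) fun i => y ⟨i, hSS' i.2⟩ :=
    fun x hx i => hx ⟨i, hSS' i.2⟩
  rw [← inter_eq_self_of_subset_right hsub, ← inter_assoc]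
  exact (hcomp _).inter_right (isClosed_jointSublevel (g := S'.restrict g) (fun i => hg i) y)

theorem isCompact_inter_jointSublevel_of_restrict (hg : ∀ i, LowerSemicontinuous (g i))
    {S : Finset ι} {y : ι → ℝ}
    (hcomp : IsCompact (K ∩ jointSublevel (S.restrict g) (S.restrict y))) :
    IsCompact (K ∩ jointSublevel g y) := by
  have hsub : jointSublevel g y ⊆ jointSublevel (S.restrict g) (S.restrict y) :=
    fun x hx i => hx i
  rw [← inter_eq_self_of_subset_right hsub, ← inter_assoc]
  exact hcomp.inter_right (isClosed_jointSublevel hg y)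

theorem exists_multiplier [AddCommGroup E] [Module ℝ E] (hg : ∀ i, IsGamma (g i))
    (hK : Convex ℝ K) {S : Finset ι}
    (hcomp : ∀ y, IsCompact (K ∩ jointSublevel (S.restrict g) y))
    (hne : (attainableLevels g K).Nonempty) {y : ι → ℝ} (hy : y ∉ attainableLevels g K) (i₀ : ι) :
    ∃ c : ι →₀ ℝ≥0, c i₀ = 1 ∧ ∀ x ∈ K,
      ((c.sum fun i r => r * y i : ℝ) : EReal) ≤ c.sum fun i r => ((r : ℝ) : EReal) * g i x := by
  obtain ⟨S', hSS', hi₀, hy'⟩ :=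
    exists_finset_restrict_notMem_attainableLevels (fun i => (hg i).lsc) (hcomp _) hy i₀
  have hne' : (attainableLevels (S'.restrict g) K).Nonempty :=
    let ⟨z, x, hxK, hx⟩ := hne
    ⟨S'.restrict z, x, hxK, fun i => hx i⟩
  obtain ⟨w, hw, hw₀, hwA⟩ := exists_pos_weights (fun i : S' => hg i) hK
    (isCompact_inter_jointSublevel_of_subset (fun i => (hg i).lsc) hSS' hcomp) hne' hy' ⟨i₀, hi₀⟩
  lift w to S' → ℝ≥0 using fun i => (hw i).le
  refine ⟨Finsupp.indicator S' fun i hi => w ⟨i, hi⟩, ?_, fun x hx => ?_⟩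
  · rw [Finsupp.indicator_of_mem hi₀]
    exact NNReal.coe_injective hw₀
  rw [Finsupp.sum_indicator_index_eq_sum_attach _ (by simp),
    Finsupp.sum_indicator_index_eq_sum_attach _ (by simp), ← Finset.univ_eq_attach]
  exact coe_le_sum_coe_mul hw (fun i => (hg i).proper.2 x) fun z hz => hwA z ⟨x, hx, hz⟩

end Multipliers

section Slice

variable {ι E : Type*} [AddCommGroup E] [Module ℝ E] [TopologicalSpace E] {g : ι → E → EReal}
  {L Y : Submodule ℝ E}

theorem apply_add_eq_of_mem (hg : ∀ i, IsGamma (g i)) (hL : ∀ d, d ∈ L ↔ ∀ i, recFun (g i) d ≤ 0)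
    {d : E} (hd : d ∈ L) (i : ι) (x : E) : g i (x + d) = g i x :=
  apply_add_eq_of_recFun_le_zero (hg i).proper.2 ((hL d).1 hd i) ((hL (-d)).1 (L.neg_mem hd) i) x

theorem exists_mem_apply_eq_of_codisjoint (hg : ∀ i, IsGamma (g i))
    (hL : ∀ d, d ∈ L ↔ ∀ i, recFun (g i) d ≤ 0) (hLY : Codisjoint L Y) (x : E) :
    ∃ x' ∈ Y, x - x' ∈ L ∧ ∀ i, g i x' = g i x := by
  obtain ⟨d, hd, x', hx', rfl⟩ := Submodule.mem_sup.1 (hLY.eq_top.ge (Submodule.mem_top (x := x)))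
  refine ⟨x', hx', by simpa using hd, fun i => ?_⟩
  rw [add_comm, apply_add_eq_of_mem hg hL hd]

variable [IsTopologicalAddGroup E] [ContinuousSMul ℝ E] {y₀ : ι → ℝ} {S : Finset ι}

theorem exists_finset_isCompact_inter_jointSublevel [LocallyConvexSpace ℝ E]
    (hg : ∀ i, IsGamma (g i))
    (hlc : LocallyCompactSpace (jointSublevel (S.restrict g) (S.restrict y₀)))
    (hY : IsClosed (Y : Set E)) (hrec : ∀ d ∈ Y, (∀ i, recFun (g i) d ≤ 0) → d = 0)
    (hne : (Y ∩ jointSublevel g y₀ : Set E).Nonempty) :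
    ∃ S', S ⊆ S' ∧ IsCompact (Y ∩ jointSublevel (S'.restrict g) (S'.restrict y₀) : Set E) := by
  let D : Finset ι → Set E := fun S => Y ∩ jointSublevel (S.restrict g) (S.restrict y₀)
  have hclosed (S : Finset ι) : IsClosed (D S) :=
    hY.inter (isClosed_jointSublevel (g := S.restrict g) (fun i => (hg i).lsc) _)
  have hanti : Antitone D := fun S S' h x hx => ⟨hx.1, fun i => hx.2 ⟨i, h i.2⟩⟩
  have hinter : ⋂ S, D S = (Y : Set E) ∩ jointSublevel g y₀ := by
    refine Subset.antisymm (fun x hx => ?_)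
      (subset_iInter fun S x hx => ⟨hx.1, fun i => hx.2 i⟩)
    rw [mem_iInter] at hx
    exact ⟨(hx ∅).1, fun i => (hx {i}).2 ⟨i, Finset.mem_singleton_self i⟩⟩
  obtain ⟨S', hS'⟩ := exists_isCompact_of_recCone_iInter_subset hanti hclosed
    (fun S => Y.convex.inter (convex_jointSublevel (g := S.restrict g) (fun i => (hg i).convex) _))
    (i₀ := S)
    (locallyCompactSpace_of_isClosed_subset hlc (hclosed S) inter_subset_right)
    (hinter ▸ hne) (by
      rw [hinter]
      intro d hd
      rw [mem_recCone_inter_jointSublevel hg Y hne] at hd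
      exact hrec d hd.1 hd.2)
  classical
  exact ⟨S ∪ S', Finset.subset_union_left, hS'.of_isClosed_subset (hclosed _)
    (hanti Finset.subset_union_right)⟩

variable [T2Space E]

theorem finiteDimensional_of_mem_iff_recFun_le_zero (hg : ∀ i, IsGamma (g i))
    (hL : ∀ d, d ∈ L ↔ ∀ i, recFun (g i) d ≤ 0) (hne : (jointSublevel g y₀).Nonempty)
    (hlc : LocallyCompactSpace (jointSublevel g y₀)) : FiniteDimensional ℝ L := by
  have hclosed : IsClosed (L : Set E) := by
    have : (L : Set E) = ⋂ i, {d | recFun (g i) d ≤ 0} := by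
      ext d
      simpa using hL d
    rw [this]
    exact isClosed_iInter fun i => (hg i).isClosed_recFun_le_zero
  obtain ⟨a, ha⟩ := hne
  exact finiteDimensional_of_add_mem hclosed hlc fun d hd i =>
    (apply_add_eq_of_mem hg hL hd i a).trans_le (ha i)

variable [LocallyConvexSpace ℝ E]

theorem exists_finset_forall_isCompact_inter_jointSublevel (hg : ∀ i, IsGamma (g i))
    (hlc : ∀ y, LocallyCompactSpace (jointSublevel (S.restrict g) y))
    (hY : IsClosed (Y : Set E)) (hrec : ∀ d ∈ Y, (∀ i, recFun (g i) d ≤ 0) → d = 0)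
    (hne : (Y ∩ jointSublevel g y₀ : Set E).Nonempty) :
    ∃ S' : Finset ι, ∀ y, IsCompact (Y ∩ jointSublevel (S'.restrict g) y : Set E) := by
  obtain ⟨S', hSS', hcomp⟩ := exists_finset_isCompact_inter_jointSublevel hg (hlc _) hY hrec hne
  obtain ⟨a, haY, ha⟩ := hne
  refine ⟨S', fun y => isCompact_inter_jointSublevel (g := S'.restrict g) (fun i => hg i) hY
    ⟨a, haY, fun i => ha i⟩ hcomp ?_⟩
  exact locallyCompactSpace_of_isClosed_subset (hlc fun i => y ⟨i, hSS' i.2⟩)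
    (hY.inter (isClosed_jointSublevel (g := S'.restrict g) (fun i => (hg i).lsc) y))
    fun x hx i => hx.2 ⟨i, hSS' i.2⟩

theorem exists_slice (hg : ∀ i, IsGamma (g i)) (hL : ∀ d, d ∈ L ↔ ∀ i, recFun (g i) d ≤ 0)
    (hlc : ∀ y, LocallyCompactSpace (jointSublevel (S.restrict g) y))
    (hne : (jointSublevel g y₀).Nonempty) :
    FiniteDimensional ℝ L ∧ ∃ Y : Submodule ℝ E,
      (∀ x, ∃ x' ∈ Y, x - x' ∈ L ∧ ∀ i, g i x' = g i x) ∧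
      ∃ S' : Finset ι, ∀ y, IsCompact (Y ∩ jointSublevel (S'.restrict g) y : Set E) := by
  have hfd : FiniteDimensional ℝ L := finiteDimensional_of_mem_iff_recFun_le_zero hg hL hne <|
    locallyCompactSpace_of_isClosed_subset (hlc (S.restrict y₀))
      (isClosed_jointSublevel (fun i => (hg i).lsc) y₀) fun x hx i => hx i
  obtain ⟨Y, hY, hLY⟩ :=
    (Submodule.ClosedComplemented.of_finiteDimensional (𝕜 := ℝ) L).exists_isClosed_isCompl
  have hproj := exists_mem_apply_eq_of_codisjoint hg hL hLY.codisjoint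
  refine ⟨hfd, Y, hproj, exists_finset_forall_isCompact_inter_jointSublevel hg hlc hY
    (fun d hdY hd => Submodule.disjoint_def.1 hLY.disjoint d ((hL d).2 hd) hdY) (y₀ := y₀) ?_⟩
  obtain ⟨a, ha⟩ := hne
  obtain ⟨a', ha'Y, -, ha'⟩ := hproj a
  exact ⟨a', ha'Y, fun i => (ha' i).trans_le (ha i)⟩

end Slice

section Lagrangian

variable {X T : Type*} {f : X → EReal} {F : T → X → EReal}

theorem infP_mono : Monotone (infP f F) :=
  fun _ _ h => biInf_mono fun _ hx t ht => hx t (h ht)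

theorem lagrangian_le {H : Finset T} {x : X} {y : H → ℝ} (hy : ∀ t : H, F t x ≤ (y t : EReal))
    (μ : H → ℝ≥0) : lagrangian f F H μ x ≤ f x + ((∑ t, μ t * y t : ℝ) : EReal) := by
  simp only [lagrangian, ereal_coe_sum, EReal.coe_mul]
  gcongr with t
  exact hy t

theorem supDFin_le_infP (H : Finset T) : supDFin f F H ≤ infP f F H :=
  iSup_le fun μ => le_iInf₂ fun x hx => iInf_le_of_le x <| by
    simpa using lagrangian_le (f := f) (F := F) (y := 0) (fun t => by simpa using hx t t.2) μ

theorem lagrangian_coe_eq_of_support_subset {l : T →₀ ℝ≥0} {H : Finset T} (hl : l.support ⊆ H)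
    (x : X) :
    lagrangian f F H (fun t => l t) x = f x + ∑ t ∈ l.support, ((l t : ℝ) : EReal) * F t x := by
  rw [lagrangian, Finset.sum_coe_sort H fun t => ((l t : ℝ) : EReal) * F t x]
  congr 1
  refine (Finset.sum_subset hl fun t _ ht => ?_).symm
  simp [Finsupp.notMem_support_iff.1 ht]

theorem supDFin_eq_iSup_support_subset (H : Finset T) :
    supDFin f F H = ⨆ (l : T →₀ ℝ≥0) (_ : l.support ⊆ H),
      ⨅ x, f x + ∑ t ∈ l.support, ((l t : ℝ) : EReal) * F t x := by
  apply le_antisymm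
  · refine iSup_le fun μ => ?_
    have hμ : μ = fun t : H => Finsupp.indicator H (fun t ht => μ ⟨t, ht⟩) t := by
      ext t
      rw [Finsupp.indicator_of_mem t.2]
    rw [hμ]
    have hl := Finsupp.support_indicator_subset H fun t ht => μ ⟨t, ht⟩
    simp only [lagrangian_coe_eq_of_support_subset hl]
    exact le_iSup₂_of_le _ hl le_rfl
  · refine iSup₂_le fun l hl => le_iSup_of_le (fun t => l t) ?_
    simp only [lagrangian_coe_eq_of_support_subset hl, le_refl]

theorem supDFin_mono : Monotone (supDFin f F) := fun H H' h => by
  simp only [supDFin_eq_iSup_support_subset]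
  exact iSup_mono fun l => iSup_const_mono fun hl => hl.trans h

theorem supD_eq_iSup_supDFin : supD f F = ⨆ H, supDFin f F H := by
  simp only [supDFin_eq_iSup_support_subset]
  rw [iSup_comm]
  exact iSup_congr fun l => (biSup_const (s := Ici l.support) nonempty_Ici).symm

theorem supD_le_infP_univ : supD f F ≤ infP f F univ :=
  supD_eq_iSup_supDFin.trans_le <| iSup_le fun H =>
    (supDFin_le_infP H).trans (infP_mono (subset_univ _))

theorem tendsto_supDFin : Tendsto (supDFin f F) atTop (𝓝 (supD f F)) :=
  supD_eq_iSup_supDFin (f := f) (F := F) ▸ tendsto_atTop_iSup supDFin_mono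

theorem tendsto_infP_of_supD_eq (h : supD f F = infP f F univ) :
    Tendsto (fun H : Finset T => infP f F (H : Set T)) atTop (𝓝 (infP f F univ)) :=
  tendsto_of_tendsto_of_tendsto_of_le_of_le (h ▸ tendsto_supDFin) tendsto_const_nhds
    supDFin_le_infP fun _ => infP_mono (subset_univ _)

end Lagrangian

section WithObjective

variable {X T : Type*} {f : X → EReal} {F : T → X → EReal} {α : ℝ}

/-- The constraints of a program together with its objective `f`, which is given the index `none`,
so that objective and constraints can be handled as one convex system. -/
def withObjective (f : X → EReal) (F : T → X → EReal) : Option T → X → EReal := fun o => o.elim f F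

/-- The levels `α` for the objective and `0` for every constraint. -/
def objectiveLevel (α : ℝ) : Option T → ℝ := fun o => o.elim α 0

theorem mem_jointSublevel_objectiveLevel {x : X} :
    x ∈ jointSublevel (withObjective f F) (objectiveLevel α) ↔
      f x ≤ (α : EReal) ∧ x ∈ feasible F univ := by
  simp [jointSublevel, Option.forall, withObjective, objectiveLevel, feasible]

theorem isGamma_withObjective [AddCommGroup X] [Module ℝ X] [TopologicalSpace X] (hf : IsGamma f)
    (hF : ∀ t, IsGamma (F t)) : ∀ o, IsGamma (withObjective f F o) :=
  Option.forall.2 ⟨hf, hF⟩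

theorem mem_recConeP_iff [AddCommGroup X] [Module ℝ X] {d : X} :
    d ∈ recConeP f F ↔ ∀ o, recFun (withObjective f F o) d ≤ 0 := by
  simp [recConeP, Option.forall, withObjective, and_comm]

theorem coe_le_supD {c : Option T →₀ ℝ≥0} (hc : c none = 1)
    (h : ∀ x, ((c.sum fun o r => r * objectiveLevel α o : ℝ) : EReal) ≤
      c.sum fun o r => ((r : ℝ) : EReal) * withObjective f F o x) : (α : EReal) ≤ supD f F := by
  refine le_iSup_of_le c.some (le_iInf fun x => ?_)
  have hx := h x
  rw [Finsupp.sum_option_index _ _ (by simp) (fun _ _ _ => by push_cast; ring),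
    Finsupp.sum_option_index _ _ (by simp) (fun _ _ _ => by
      push_cast; exact EReal.right_distrib_of_nonneg (by positivity) (by positivity))] at hx
  simpa [hc, withObjective, objectiveLevel, Finsupp.sum] using hx

end WithObjective

section Program

variable {E T : Type*} {f : E → EReal} {F : T → E → EReal}

theorem exists_mem_jointSublevel_of_infP_ne_top (hfin : infP f F univ ≠ ⊤) :
    ∃ α, (jointSublevel (withObjective f F) (objectiveLevel α)).Nonempty := by
  obtain ⟨x, hx⟩ := iInf_lt_iff.1 (lt_top_iff_ne_top.2 hfin)
  obtain ⟨hxF, hx⟩ := iInf_lt_iff.1 hx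
  obtain ⟨α, hα, -⟩ := EReal.lt_iff_exists_real_btwn.1 hx
  exact ⟨α, x, mem_jointSublevel_objectiveLevel.2 ⟨hα.le, hxF⟩⟩

theorem sol_univ_eq_jointSublevel {v : ℝ} (hv : infP f F univ = (v : EReal)) :
    sol f F univ = jointSublevel (withObjective f F) (objectiveLevel v) := by
  ext x
  rw [mem_jointSublevel_objectiveLevel, ← hv]
  exact ⟨fun hx => ⟨hx.2.le, hx.1⟩, fun hx => ⟨hx.2, hx.1.antisymm (iInf₂_le x hx.2)⟩⟩

theorem locallyCompactSpace_jointSublevel_of_lagrangian [TopologicalSpace E]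
    (hf : LowerSemicontinuous f) (hF : ∀ t, LowerSemicontinuous (F t)) {H : Finset T} {μ : H → ℝ≥0}
    (hlc : ∀ r : ℝ, LocallyCompactSpace {x | lagrangian f F H μ x ≤ (r : EReal)})
    (y : Finset.insertNone H → ℝ) :
    LocallyCompactSpace (jointSublevel ((Finset.insertNone H).restrict (withObjective f F)) y) := by
  have hlsc : ∀ o, LowerSemicontinuous (withObjective f F o) := Option.forall.2 ⟨hf, hF⟩
  let y₀ : ℝ := y ⟨none, Finset.none_mem_insertNone⟩
  let y₁ : H → ℝ := fun t => y ⟨some t, Finset.some_mem_insertNone.2 t.2⟩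
  refine locallyCompactSpace_of_isClosed_subset (hlc (y₀ + ∑ t, μ t * y₁ t))
    (isClosed_jointSublevel (g := (Finset.insertNone H).restrict (withObjective f F))
      (fun o => hlsc o) y) fun x hx => ?_
  refine (lagrangian_le (y := y₁) (fun t => hx ⟨some t, _⟩) μ).trans ?_
  rw [EReal.coe_add]
  exact add_le_add_left (hx ⟨none, _⟩) _

section Slice

variable {K : Set E} (hproj : ∀ x, ∃ x' ∈ K, ∀ o, withObjective f F o x' = withObjective f F o x)

include hproj

theorem inter_jointSublevel_nonempty_iff {y : Option T → ℝ} :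
    (K ∩ jointSublevel (withObjective f F) y).Nonempty ↔
      (jointSublevel (withObjective f F) y).Nonempty := by
  refine ⟨fun h => h.mono inter_subset_right, fun ⟨x, hx⟩ => ?_⟩
  obtain ⟨x', hx'K, hx'⟩ := hproj x
  exact ⟨x', hx'K, fun o => (hx' o).trans_le (hx o)⟩

variable [TopologicalSpace E]

theorem exists_mem_feasible_eq_infP (hf : LowerSemicontinuous f) (hfin : infP f F univ ≠ ⊤)
    (hcomp : ∀ y, IsCompact (K ∩ jointSublevel (withObjective f F) y)) :
    ∃ z ∈ feasible F univ, f z = infP f F univ := by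
  obtain ⟨α, hα⟩ := exists_mem_jointSublevel_of_infP_ne_top hfin
  obtain ⟨z, ⟨-, hz⟩, hmin⟩ := (hf.lowerSemicontinuousOn _).exists_isMinOn
    ((inter_jointSublevel_nonempty_iff hproj).2 hα) (hcomp _)
  rw [mem_jointSublevel_objectiveLevel] at hz
  refine ⟨z, hz.2, le_antisymm (le_iInf₂ fun x hx => ?_) (iInf₂_le z hz.2)⟩
  rcases le_total (f x) α with hle | hle
  · obtain ⟨x', hx'K, hx'⟩ := hproj x
    have hx'mem : x' ∈ jointSublevel (withObjective f F) (objectiveLevel α) := fun o =>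
      (hx' o).trans_le (mem_jointSublevel_objectiveLevel.2 ⟨hle, hx⟩ o)
    exact (hmin ⟨hx'K, hx'mem⟩).trans_eq (hx' none)
  · exact hz.1.trans hle

theorem supD_eq_infP_univ [AddCommGroup E] [Module ℝ E] (hf : IsGamma f) (hF : ∀ t, IsGamma (F t))
    (hfin : infP f F univ ≠ ⊤) (hK : Convex ℝ K) {S : Finset (Option T)}
    (hcomp : ∀ y, IsCompact (K ∩ jointSublevel (S.restrict (withObjective f F)) y)) :
    supD f F = infP f F univ := by
  refine supD_le_infP_univ.antisymm <| EReal.ge_of_forall_gt_iff_ge.1 fun α hα => ?_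
  have hne : (attainableLevels (withObjective f F) K).Nonempty :=
    let ⟨r, hr⟩ := exists_mem_jointSublevel_of_infP_ne_top hfin
    ⟨objectiveLevel r, (inter_jointSublevel_nonempty_iff hproj).2 hr⟩
  have hα' : objectiveLevel α ∉ attainableLevels (withObjective f F) K := by
    rintro ⟨x, -, hx⟩
    rw [mem_jointSublevel_objectiveLevel] at hx
    exact hα.not_ge ((iInf₂_le x hx.2).trans hx.1)
  obtain ⟨c, hc, hle⟩ := exists_multiplier (isGamma_withObjective hf hF) hK hcomp hne hα' none
  refine coe_le_supD hc fun x => ?_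
  obtain ⟨x', hx'K, hx'⟩ := hproj x
  simpa only [hx'] using hle x' hx'K

end Slice

variable [AddCommGroup E] [Module ℝ E] [TopologicalSpace E]

theorem sol_eq_inter_add {K : Set E} {L : Submodule ℝ E} (hf : IsGamma f) (hF : ∀ t, IsGamma (F t))
    (hL : recConeP f F = L)
    (hproj : ∀ x, ∃ x' ∈ K, x - x' ∈ L ∧ ∀ o, withObjective f F o x' = withObjective f F o x)
    {v : ℝ} (hv : infP f F univ = (v : EReal)) :
    sol f F univ = K ∩ sol f F univ + (L : Set E) := by
  rw [sol_univ_eq_jointSublevel hv]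
  ext x
  constructor
  · intro hx
    obtain ⟨x', hx'K, hsub, hx'⟩ := hproj x
    exact ⟨x', ⟨hx'K, fun o => (hx' o).trans_le (hx o)⟩, x - x', hsub, add_sub_cancel x' x⟩
  · rintro ⟨x', ⟨-, hx'⟩, d, hd, rfl⟩ o
    refine (apply_add_eq_of_mem (isGamma_withObjective hf hF) (fun d => ?_) hd o x').trans_le
      (hx' o)
    rw [← mem_recConeP_iff, hL, SetLike.mem_coe]

variable [IsTopologicalAddGroup E] [ContinuousSMul ℝ E] [LocallyConvexSpace ℝ E] [T2Space E]

theorem exists_eq_supD_and_sol_eq_add (hf : IsGamma f) (hF : ∀ t, IsGamma (F t))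
    (hfin : infP f F univ ≠ ⊤) {H : Finset T} {μ : H → ℝ≥0}
    (hlc : ∀ r : ℝ, LocallyCompactSpace {x | lagrangian f F H μ x ≤ (r : EReal)})
    {L : Submodule ℝ E} (hL : recConeP f F = L) :
    (∃ v : ℝ, (∃ x ∈ feasible F univ, f x = (v : EReal)) ∧ infP f F univ = (v : EReal) ∧
      supD f F = (v : EReal)) ∧
    ∃ C : Set E, IsCompact C ∧ Convex ℝ C ∧ FiniteDimensional ℝ L ∧
      sol f F univ = C + (L : Set E) := by
  have hG := isGamma_withObjective hf hF
  obtain ⟨α, hα⟩ := exists_mem_jointSublevel_of_infP_ne_top hfin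
  obtain ⟨hfd, Y, hproj, S, hcomp⟩ := exists_slice (L := L) hG
    (fun d => by rw [← mem_recConeP_iff, hL, SetLike.mem_coe])
    (locallyCompactSpace_jointSublevel_of_lagrangian hf.lsc (fun t => (hF t).lsc) hlc) hα
  have hproj' (x : E) : ∃ x' ∈ Y, ∀ o, withObjective f F o x' = withObjective f F o x :=
    (hproj x).imp fun _ h => ⟨h.1, h.2.2⟩
  have hcomp' (y : Option T → ℝ) : IsCompact (Y ∩ jointSublevel (withObjective f F) y : Set E) :=
    isCompact_inter_jointSublevel_of_restrict (fun o => (hG o).lsc) (hcomp (S.restrict y))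
  obtain ⟨z, hzF, hz⟩ := exists_mem_feasible_eq_infP hproj' hf.lsc hfin hcomp'
  have hbot : infP f F univ ≠ ⊥ := hz ▸ hf.proper.2 z
  obtain ⟨v, hv⟩ : ∃ v : ℝ, infP f F univ = (v : EReal) :=
    ⟨_, (EReal.coe_toReal hfin hbot).symm⟩
  have hdual := supD_eq_infP_univ hproj' hf hF hfin Y.convex hcomp
  refine ⟨⟨v, ⟨z, hzF, hz.trans hv⟩, hv, hdual.trans hv⟩, Y ∩ sol f F univ, ?_, ?_, hfd,
    sol_eq_inter_add hf hF hL hproj hv⟩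
  · rw [sol_univ_eq_jointSublevel hv]
    exact hcomp' _
  · rw [sol_univ_eq_jointSublevel hv]
    exact Y.convex.inter (convex_jointSublevel (fun o => (hG o).convex) _)

end Program

section WeakSpace

variable {X : Type*} [AddCommGroup X] [Module ℝ X] [TopologicalSpace X]
  [IsTopologicalAddGroup X] [ContinuousSMul ℝ X]

instance : LocallyConvexSpace ℝ (WeakSpace ℝ X) :=
  inferInstanceAs (LocallyConvexSpace ℝ (WeakBilin (topDualPairing ℝ X).flip))

variable [LocallyConvexSpace ℝ X]

theorem isClosed_toWeakSpace_image {A : Set X} (hA : IsClosed A) (hconv : Convex ℝ A) :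
    IsClosed (toWeakSpace ℝ X '' A) := by
  rw [← hA.closure_eq, hconv.toWeakSpace_closure ℝ]
  exact isClosed_closure

theorem IsGamma.weakSpace {h : X → EReal} (hh : IsGamma h) :
    IsGamma (h ∘ (toWeakSpace ℝ X).symm) where
  proper := hh.proper
  convex := hh.convex
  lsc := by
    refine lowerSemicontinuous_iff_isClosed_preimage.2 fun y => ?_
    rw [preimage_comp, ← (toWeakSpace ℝ X).image_eq_preimage_symm]
    exact isClosed_toWeakSpace_image (hh.lsc.isClosed_preimage y)
      (convex_preimage_Iic_of_convex_epi hh.convex y)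

end WeakSpace

end InfConvex

theorem corollary7_general {X T : Type*} [AddCommGroup X] [Module ℝ X] [TopologicalSpace X]
    [IsTopologicalAddGroup X] [ContinuousSMul ℝ X] [LocallyConvexSpace ℝ X] [T2Space X]
    (f : X → EReal) (F : T → X → EReal)
    (hf : InfConvex.IsGamma f) (hF : ∀ t, InfConvex.IsGamma (F t))
    (hfin : InfConvex.infP f F Set.univ ≠ ⊤)
    (hg : ∃ (H : Finset T) (μ : H → ℝ≥0),
      InfConvex.WeaklyInfLocallyCompact (InfConvex.lagrangian f F H μ))
    (he : ∃ L : Submodule ℝ X, InfConvex.recConeP f F = (L : Set X)) :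
    (∃ v : ℝ,
      (∃ x ∈ InfConvex.feasible F Set.univ, f x = (v : EReal)) ∧
      InfConvex.infP f F Set.univ = (v : EReal) ∧
      Tendsto (fun H : Finset T => InfConvex.infP f F H) atTop (𝓝 (v : EReal)) ∧
      Tendsto (fun H : Finset T => InfConvex.supDFin f F H) atTop (𝓝 (v : EReal)) ∧
      InfConvex.supD f F = (v : EReal)) ∧
    ∃ (C : Set X) (L : Submodule ℝ X),
      InfConvex.WeaklyCompact C ∧ Convex ℝ C ∧ FiniteDimensional ℝ L ∧
      InfConvex.sol f F Set.univ = C + (L : Set X) := by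
  obtain ⟨H, μ, hlc⟩ := hg
  obtain ⟨L, hL⟩ := he
  -- `WeakSpace ℝ X` is a type synonym of `X`, so everything in the problem that does not mention
  -- the topology is unchanged by definition when `X` is given its weak topology.
  have hlc' (r : ℝ) : LocallyCompactSpace {x : WeakSpace ℝ X |
      InfConvex.lagrangian (f ∘ (toWeakSpace ℝ X).symm)
        (fun t => F t ∘ (toWeakSpace ℝ X).symm) H μ x ≤ (r : EReal)} := by
    have := hlc r
    rwa [InfConvex.WeaklyLocallyCompact, (toWeakSpace ℝ X).image_eq_preimage_symm] at this
  obtain ⟨⟨v, hmin, hP, hD⟩, C, hC, hconv, hfd, hsol⟩ :=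
    InfConvex.exists_eq_supD_and_sol_eq_add (E := WeakSpace ℝ X) hf.weakSpace
      (fun t => (hF t).weakSpace) hfin hlc' hL
  refine ⟨⟨v, hmin, hP, ?_, ?_, hD⟩, C, L, ?_, hconv, hfd, hsol⟩
  · exact hP ▸ InfConvex.tendsto_infP_of_supD_eq (hD.trans hP.symm)
  · exact hD ▸ InfConvex.tendsto_supDFin
  · rwa [← Set.image_id C] at hC

theorem corollary7 {X : Type*} [AddCommGroup X] [Module ℝ X] [TopologicalSpace X]
    [IsTopologicalAddGroup X] [ContinuousSMul ℝ X] [LocallyConvexSpace ℝ X] [T2Space X]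
    (f : X → EReal) (F : ℕ+ → X → EReal)
    (hf : InfConvex.IsGamma f) (hF : ∀ k, InfConvex.IsGamma (F k))
    (hfin : InfConvex.infP f F Set.univ ≠ ⊤)
    (hg : ∃ (N : ℕ+) (μ : (Finset.Icc 1 N : Finset ℕ+) → ℝ≥0),
      InfConvex.WeaklyInfLocallyCompact (InfConvex.lagrangian f F (Finset.Icc 1 N) μ))
    (he : ∃ L : Submodule ℝ X, InfConvex.recConeP f F = (L : Set X)) :
    (∃ v : ℝ,
      (∃ x ∈ InfConvex.feasible F Set.univ, f x = (v : EReal)) ∧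
      InfConvex.infP f F Set.univ = (v : EReal) ∧
      Tendsto (fun m : ℕ+ => InfConvex.infP f F (Set.Icc 1 m)) atTop (𝓝 (v : EReal)) ∧
      Tendsto (fun m : ℕ+ => InfConvex.supDFin f F (Finset.Icc 1 m)) atTop (𝓝 (v : EReal)) ∧
      InfConvex.supD f F = (v : EReal)) ∧
    ∃ (C : Set X) (L : Submodule ℝ X),
      InfConvex.WeaklyCompact C ∧ Convex ℝ C ∧ FiniteDimensional ℝ L ∧
      InfConvex.sol f F Set.univ = C + (L : Set X) := by
  have hIcc : Tendsto (fun m : ℕ+ => Finset.Icc 1 m) atTop atTop := tendsto_finset_Iic_atTop_atTop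
  obtain ⟨⟨v, hmin, hP, hlimP, hlimD, hD⟩, hsol⟩ :=
    corollary7_general f F hf hF hfin (hg.imp' _ fun _ => id) he
  refine ⟨⟨v, hmin, hP, ?_, hlimD.comp hIcc, hD⟩, hsol⟩
  simpa only [Function.comp_def, Finset.coe_Icc] using hlimP.comp hIcc
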